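/- Let $\mathcal H$ be a complex Hilbert space with scalar product $(x|y)$ (linear in $x$), $H_0$ a closed operator in $\mathcal H$ with dense domain $\mathcal D$, and $H_1$ an operator in $\mathcal H$ with $\mathcal D(H_1)\supset\mathcal D$. Let $J$ be a unitary involution of $\mathcal H$ ($J^2=1$, $J^*=J^{-1}$) that maps $\mathcal D$ into $\mathcal D$ and satisfies $JH_0=H_0^*J$ (equality of operators, including domains) and $JH_1=H_1^*J$ on $\mathcal D$. (These hypotheses imply that $H_1$ is bounded relative to $H_0$.) For $\epsilon\in\mathbb R$ put $H_\epsilon=H_0+\epsilon H_1$ with domain $\mathcal D$. Let $\lambda_0\in\mathbb R$ be an eigenvalue of $H_0$ that is an isolated point of the spectrum of $H_0$ and whose geometric multiplicity (the dimension of the eigenspace $E=\ker(H_0-\lambda_0)$) and algebraic multiplicity (the rank of the Riesz projection $-\frac1{2\pi i}\oint_{|z-\lambda_0|=r}(H_0-z)^{-1}dz$, $r>0$ small) are both equal to $2$. Let $e_1,e_2$ be a basis of $E$ in which $$(Ju|u)=\tau_1|u_1|^2+\tau_2|u_2|^2,\qquad u=u_1e_1+u_2e_2,\qquad \tau_1,\tau_2\in\{1,-1\},$$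 let $e_1^*,e_2^*$ be the dual basis of $JE$, i.e. $(e_j|e_k^*)=\delta_{jk}$ (so that $e_j^*=\tau_jJe_j$), and put $H_{jk}=(H_1e_j|e_k^*)$. Then $H_{11}$ and $H_{22}$ are real, and for every $\delta>0$ there is $\epsilon^*>0$ such that: (i) if $\tau_1\tau_2=-1$ and $4|H_{12}|^2>(H_{11}-H_{22})^2$, then for all real $\epsilon$ with $0<|\epsilon|<\epsilon^*$ the operator $H_\epsilon$ has a pair of non-real complex conjugate eigenvalues $z,\overline z$ with $|z-\lambda_0|<\delta$; (ii) if $\tau_1\tau_2=1$, then for all real $\epsilon$ with $|\epsilon|<\epsilon^*$ the operator $H_\epsilon$ has two real eigenvalues in $(\lambda_0-\delta,\lambda_0+\delta)$, counted with multiplicity; that is, there are two linearly independent eigenvectors of $H_\epsilon$ whose eigenvalues $\mu_1,\mu_2$ (possibly equal) are real and satisfy $|\mu_j-\lambda_0|<\delta$. -/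

import Mathlib

open scoped ComplexConjugate

noncomputable section

namespace PTPerturb

variable {H : Type*} [NormedAddCommGroup H] [InnerProductSpace ℂ H] [CompleteSpace H]

/-- The bounded operator `R` is the inverse `(A - z)⁻¹` of `A - z : D(A) → H`. -/
def IsResolventAt (A : H →ₗ.[ℂ] H) (z : ℂ) (R : H →L[ℂ] H) : Prop :=
  (∀ f : H, ∃ h : R f ∈ A.domain, A ⟨R f, h⟩ - z • R f = f) ∧
    ∀ u : A.domain, R (A u - z • (u : H)) = u

/-- The resolvent set: those `z` for which `A - z` has a bounded, everywhere defined inverse. -/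
def resolventSet (A : H →ₗ.[ℂ] H) : Set ℂ :=
  {z | ∃ R : H →L[ℂ] H, IsResolventAt A z R}

open Classical in
/-- The resolvent `(A - z)⁻¹` (unique) for `z` in the resolvent set of `A`, and `0` elsewhere. -/
def resolventOp (A : H →ₗ.[ℂ] H) (z : ℂ) : H →L[ℂ] H :=
  if h : z ∈ resolventSet A then h.choose else 0

/-- The Riesz integral `-(2πi)⁻¹ ∮ (A - z)⁻¹ dz` over the circle of centre `c` and radius `r`. -/
def rieszProjection (A : H →ₗ.[ℂ] H) (c : ℂ) (r : ℝ) : H →L[ℂ] H :=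
  -((2 * (Real.pi : ℂ) * Complex.I)⁻¹ • ∮ z in C(c, r), resolventOp A z)

/-- `z` is an eigenvalue of `A` with eigenvector `u`. -/
def IsEigenvector (A : H →ₗ.[ℂ] H) (z : ℂ) (u : H) : Prop :=
  u ≠ 0 ∧ ∃ h : u ∈ A.domain, A ⟨u, h⟩ = z • u

/-- `z` is an eigenvalue of `A`. -/
def IsEigenvalue (A : H →ₗ.[ℂ] H) (z : ℂ) : Prop :=
  ∃ u : H, IsEigenvector A z u

/-- The eigenspace `ker (A - z)`, as a subspace of `H`. -/
def eigenspace (A : H →ₗ.[ℂ] H) (z : ℂ) : Submodule ℂ H :=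
  (LinearMap.ker (A.toFun - z • A.domain.subtype)).map A.domain.subtype

/-- `c` is an eigenvalue of `A`, isolated in the spectrum of `A`, whose geometric multiplicity
(dimension of the eigenspace) and algebraic multiplicity (rank of the Riesz projection over a small
circle around `c`) both equal `n`. -/
def IsIsolatedSemisimpleEigenvalue (A : H →ₗ.[ℂ] H) (c : ℂ) (n : ℕ) : Prop :=
  IsEigenvalue A c ∧ Module.finrank ℂ (eigenspace A c) = n ∧
    ∃ r : ℝ, 0 < r ∧ (∀ z : ℂ, 0 < ‖z - c‖ → ‖z - c‖ ≤ r → z ∈ resolventSet A) ∧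
      Module.finrank ℂ (LinearMap.range (rieszProjection A c r : H →ₗ[ℂ] H)) = n

/-- The equality `J A = A* J` of unbounded operators, equality of the domains included. -/
def Intertwines (J : H ≃ₗᵢ[ℂ] H) (A : H →ₗ.[ℂ] H) : Prop :=
  (∀ u : H, u ∈ A.domain ↔ J u ∈ A.adjoint.domain) ∧
    ∀ (u : A.domain) (h : J u ∈ A.adjoint.domain), A.adjoint ⟨J u, h⟩ = J (A u)

/-- The equality `J A = A* J` on the subspace `D` of the domain of `A`. -/
def IntertwinesOn (J : H ≃ₗᵢ[ℂ] H) (A : H →ₗ.[ℂ] H) (D : Submodule ℂ H) : Prop :=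
  ∀ u : A.domain, (u : H) ∈ D →
    ∃ h : J u ∈ A.adjoint.domain, A.adjoint ⟨J u, h⟩ = J (A u)

/-- The vectors `e 0, e 1` form a basis of the subspace `E` in which the Hermitian form `(J u | u)`
reads `τ 0 |u₀|² + τ 1 |u₁|²`, with signs `τ j = ± 1`. -/
structure IsCanonicalBasis (J : H ≃ₗᵢ[ℂ] H) (E : Submodule ℂ H) (e : Fin 2 → H) (τ : Fin 2 → ℝ) :
    Prop where
  linearIndependent : LinearIndependent ℂ e
  span_eq : Submodule.span ℂ (Set.range e) = E
  sign : ∀ j, τ j = 1 ∨ τ j = -1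
  /- Mathlib's inner product is conjugate linear in its first argument: `(x | y) = ⟪y, x⟫`. -/
  form_eq : ∀ c : Fin 2 → ℂ,
    inner ℂ (∑ j, c j • e j) (J (∑ j, c j • e j)) = ((∑ j, τ j * ‖c j‖ ^ 2 : ℝ) : ℂ)

/-- The vectors `e' 0, e' 1` form the basis of `J E` that is dual to the basis `e` of `E`. -/
def IsDualBasis (J : H ≃ₗᵢ[ℂ] H) (E : Submodule ℂ H) (e e' : Fin 2 → H) : Prop :=
  (∀ j, ∃ u ∈ E, e' j = J u) ∧ ∀ j k, inner ℂ (e' j) (e k) = if j = k then (1 : ℂ) else 0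

end PTPerturb

end

/-! The eigenvalue problem for $H_\epsilon$ near $\lambda_0$ reduces to a $2\times2$ determinant.
Equality of the two multiplicities makes the range of the Riesz projection equal to $E$, so
$H_0-\lambda_0$ has a bounded inverse $S$ modulo $E$; $T=H_1S$ is bounded by the closed graph
theorem. Solving the equation outside $E$ with $(1-\mu S+\epsilon T)^{-1}$ leaves a matrix
$M(\mu,\epsilon)=\epsilon V(\mu,\epsilon)-\mu$ on $E$, and each null vector of $M$ gives an
eigenvector of $H_\epsilon$ for $\lambda_0+\mu$ (`exists_eigenvector`). The $J$-symmetry of $H_0$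
and $H_1$ passes to $M$, with the signs $\tau_j$ (`secularMatrix_symm`).

If $\tau_1=\tau_2$, then $M$ is Hermitian for real $\mu$, and the intermediate value theorem gives a
real fixed point on each eigenvalue branch of $\epsilon V$ (`exists_real_roots`). If
$\tau_1=-\tau_2$, put $\mu=\epsilon s$ and divide the determinant by $\epsilon^2$: at $\epsilon=0$
it becomes $(H_{11}-s)(H_{22}-s)+|H_{12}|^2$, which has simple non-real roots under the hypothesis
of (i). They persist by the implicit function theorem (`exists_tendsto_zero_of_hasDerivAt`). -/

namespace PTPerturb

/-! ### Resolvents, the Riesz projection and the reduced resolvent. -/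

section Resolvent

variable {H : Type*} [NormedAddCommGroup H] [InnerProductSpace ℂ H] {A : H →ₗ.[ℂ] H}

theorem resolventOp_spec {z : ℂ} (hz : z ∈ resolventSet A) :
    IsResolventAt A z (resolventOp A z) := by
  rw [resolventOp, dif_pos hz]
  exact hz.choose_spec

/-- The first resolvent identity. -/
theorem IsResolventAt.sub_eq {z w : ℂ} {R S : H →L[ℂ] H} (hR : IsResolventAt A z R)
    (hS : IsResolventAt A w S) : R = S * (1 + (z - w) • R) := by
  ext f
  obtain ⟨h, hf⟩ := hR.1 f
  have h1 := hS.2 ⟨R f, h⟩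
  have h2 : A ⟨R f, h⟩ - w • R f = f + (z - w) • R f := by
    rw [sub_eq_iff_eq_add.1 hf]
    module
  simp only [h2] at h1
  simpa using h1.symm

theorem IsResolventAt.apply_eigenvector {z c : ℂ} {R : H →L[ℂ] H} (hR : IsResolventAt A z R)
    {u : A.domain} (hu : A u = c • (u : H)) (hz : z ≠ c) : R u = -((z - c)⁻¹ • (u : H)) := by
  have h1 := hR.2 u
  have hz' : z - c ≠ 0 := sub_ne_zero.2 hz
  rw [hu, ← sub_smul, map_smul] at h1
  have hcz : -(z - c)⁻¹ * (c - z) = 1 := by field_simp; ring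
  calc R u = (-(z - c)⁻¹ * (c - z)) • R u := by rw [hcz, one_smul]
    _ = -((z - c)⁻¹ • (u : H)) := by rw [mul_smul, h1, neg_smul]

/-- Near $w$ the resolvent identity gives $R(z)=(1-(z-w)R(w))^{-1}R(w)$, and inversion is continuous
at $1$. -/
theorem continuousOn_resolventOp [CompleteSpace H] :
    ContinuousOn (resolventOp A) (resolventSet A) := by
  intro w hw
  set S := resolventOp A w with hS
  have key : ∀ z ∈ resolventSet A, ∀ (_ : IsUnit (1 - (z - w) • S)),
      resolventOp A z = Ring.inverse (1 - (z - w) • S) * S := by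
    intro z hz hu
    have h := (resolventOp_spec hw).sub_eq (resolventOp_spec hz)
    have h' := (resolventOp_spec hz).sub_eq (resolventOp_spec hw)
    rw [← hS] at h h'
    have h2 : (1 - (z - w) • S) * resolventOp A z = S := by
      rw [sub_mul, one_mul, sub_eq_iff_eq_add]
      conv_lhs => rw [h']
      simp [mul_add]
    calc resolventOp A z
        = Ring.inverse (1 - (z - w) • S) * ((1 - (z - w) • S) * resolventOp A z) :=
          (Ring.inverse_mul_cancel_left _ _ hu).symm
      _ = _ := by rw [h2]
  have hc : ContinuousAt (fun z : ℂ => 1 - (z - w) • S) w := by fun_prop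
  have h1 : (1 : H →L[ℂ] H) - (w - w) • S = ((1 : (H →L[ℂ] H)ˣ) : H →L[ℂ] H) := by simp
  have hunit : ∀ᶠ z in nhds w, IsUnit (1 - (z - w) • S) := by
    apply hc.eventually
    simp only [h1]
    exact Units.nhds 1
  have hcont : ContinuousAt (fun z : ℂ => Ring.inverse (1 - (z - w) • S) * S) w := by
    refine ContinuousAt.mul (ContinuousAt.comp (g := Ring.inverse) ?_ hc) continuousAt_const
    rw [h1]
    exact NormedRing.inverse_continuousAt 1
  refine hcont.continuousWithinAt.congr_of_eventuallyEq ?_ (key w hw hunit.self_of_nhds)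
  filter_upwards [self_mem_nhdsWithin, nhdsWithin_le_nhds hunit] with z hz hu
  exact key z hz hu

theorem circleIntegral_clm_comp {E F : Type*} [NormedAddCommGroup E] [NormedSpace ℂ E]
    [NormedAddCommGroup F] [NormedSpace ℂ F] [CompleteSpace E] [CompleteSpace F]
    (L : E →L[ℂ] F) {f : ℂ → E} {c : ℂ} {r : ℝ} (hf : CircleIntegrable f c r) :
    (∮ z in C(c, r), L (f z)) = L (∮ z in C(c, r), f z) := by
  rw [circleIntegral, circleIntegral, ← L.intervalIntegral_comp_comm]
  · simp
  · exact hf.out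

theorem mem_eigenspace {c : ℂ} {u : H} :
    u ∈ eigenspace A c ↔ ∃ h : u ∈ A.domain, A ⟨u, h⟩ = c • u := by
  simp only [eigenspace, Submodule.mem_map, LinearMap.mem_ker, LinearMap.sub_apply,
    LinearMap.smul_apply, Submodule.subtype_apply, sub_eq_zero]
  constructor
  · rintro ⟨v, hv, rfl⟩
    exact ⟨v.2, hv⟩
  · rintro ⟨h, hu⟩
    exact ⟨⟨u, h⟩, hu, rfl⟩

section Riesz

variable [CompleteSpace H] {c : ℂ} {r : ℝ}

/-- On an eigenvector the resolvent is multiplication by $-(z-c)^{-1}$, so only $\oint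
(z-c)^{-1}dz=2\pi i$ remains. -/
theorem rieszProjection_apply_eigenvector (hr : 0 < r)
    (hres : Metric.sphere c r ⊆ resolventSet A) {u : H} (hu : u ∈ eigenspace A c) :
    rieszProjection A c r u = u := by
  obtain ⟨h, hu⟩ := mem_eigenspace.1 hu
  have hint : CircleIntegrable (resolventOp A) c r :=
    (continuousOn_resolventOp.mono hres).circleIntegrable hr.le
  have h1 : (∮ z in C(c, r), resolventOp A z) u = ∮ z in C(c, r), resolventOp A z u :=
    (circleIntegral_clm_comp (ContinuousLinearMap.apply ℂ H u) hint).symm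
  have h2 : (∮ z in C(c, r), resolventOp A z u) = ∮ z in C(c, r), (z - c)⁻¹ • (-u) := by
    refine circleIntegral.integral_congr hr.le fun z hz => ?_
    have hzc : z ≠ c := by
      rintro rfl
      simp at hz
      exact hr.ne hz
    simpa using (resolventOp_spec (hres hz)).apply_eigenvector (u := ⟨u, h⟩) hu hzc
  rw [rieszProjection, neg_apply, smul_apply, h1, h2,
    circleIntegral.integral_smul_const, circleIntegral.integral_sub_center_inv c hr.ne', smul_smul,
    inv_mul_cancel₀ Complex.two_pi_I_ne_zero]
  simp

/-- A bounded right inverse of `A - c` modulo the Riesz projection: the reduced resolvent. -/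
theorem exists_reduced_resolvent (hr : 0 < r) (hres : Metric.sphere c r ⊆ resolventSet A) :
    ∃ S : H →L[ℂ] H, ∀ f, ∃ h : S f ∈ A.domain,
      A ⟨S f, h⟩ - c • S f = f - rieszProjection A c r f := by
  -- The unbounded `A` is never moved under an integral: $R(z)=R(w)(1+(z-w)R(z))$ with $w$ fixed
  -- factors the integral `S` as `R * K`, and `A` then acts on the range of the single resolvent
  -- `R`.
  obtain ⟨w, hw⟩ : (Metric.sphere c r).Nonempty := (NormedSpace.sphere_nonempty).2 hr.le
  set R := resolventOp A w
  have hR : IsResolventAt A w R := resolventOp_spec (hres hw)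
  have hcont : ContinuousOn (resolventOp A) (Metric.sphere c r) := continuousOn_resolventOp.mono hres
  have hne : ∀ z ∈ Metric.sphere c r, z - c ≠ 0 := by
    intro z hz h
    rw [sub_eq_zero.1 h] at hz
    simp at hz
    exact hr.ne hz
  have hinv : ContinuousOn (fun z : ℂ => (z - c)⁻¹) (Metric.sphere c r) :=
    ContinuousOn.inv₀ (by fun_prop) hne
  have hint := hcont.circleIntegrable hr.le
  have hint1 : CircleIntegrable (fun z => (z - c)⁻¹ • resolventOp A z) c r :=
    (hinv.smul hcont).circleIntegrable hr.le
  have hint2 : CircleIntegrable (fun z => (z - c)⁻¹ • (1 : H →L[ℂ] H)) c r :=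
    (hinv.smul continuousOn_const).circleIntegrable hr.le
  have hint4 : CircleIntegrable (fun z => (c - w) • ((z - c)⁻¹ • resolventOp A z)) c r :=
    ((hinv.smul hcont).const_smul (c - w)).circleIntegrable hr.le
  have hint3 : CircleIntegrable (fun z => (z - c)⁻¹ • (1 + (z - w) • resolventOp A z)) c r := by
    have h1 : ContinuousOn (fun z : ℂ => z - w) (Metric.sphere c r) := by fun_prop
    have h2 : ContinuousOn (fun z : ℂ => (1 : H →L[ℂ] H) + (z - w) • resolventOp A z)
      (Metric.sphere c r) := continuousOn_const.add (h1.smul hcont)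
    exact (hinv.smul h2).circleIntegrable hr.le
  set k : ℂ := (2 * (Real.pi : ℂ) * Complex.I)⁻¹ with hk
  obtain ⟨S, hS⟩ : ∃ S : H →L[ℂ] H, S = k • ∮ z in C(c, r), (z - c)⁻¹ • resolventOp A z := ⟨_, rfl⟩
  obtain ⟨K, hK⟩ : ∃ K : H →L[ℂ] H,
    K = k • ∮ z in C(c, r), (z - c)⁻¹ • (1 + (z - w) • resolventOp A z) := ⟨_, rfl⟩
  have hSK : S = R * K := by
    rw [hS, hK, mul_smul_comm]
    congr 1
    refine Eq.trans ?_ (circleIntegral_clm_comp (ContinuousLinearMap.mul ℂ (H →L[ℂ] H) R) hint3)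
    refine circleIntegral.integral_congr hr.le fun z hz => ?_
    change _ = R * ((z - c)⁻¹ • (1 + (z - w) • resolventOp A z))
    rw [mul_smul_comm, ← (resolventOp_spec (hres hz)).sub_eq hR]
  -- Split $(z-w)/(z-c)=1+(c-w)/(z-c)$ in the integrand of `K`.
  have hKS : K = 1 - rieszProjection A c r + (c - w) • S := by
    have h1 : (∮ z in C(c, r), (z - c)⁻¹ • (1 + (z - w) • resolventOp A z)) =
        ∮ z in C(c, r), (((z - c)⁻¹ • (1 : H →L[ℂ] H) + resolventOp A z) +
          (c - w) • ((z - c)⁻¹ • resolventOp A z)) := by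
      refine circleIntegral.integral_congr hr.le fun z hz => ?_
      have := hne z hz
      have h2 : (z - c)⁻¹ * (z - w) = 1 + (c - w) * (z - c)⁻¹ := by field_simp; ring
      simp only [smul_add, smul_smul, h2, add_smul, one_smul]
      abel
    have h2 := circleIntegral.integral_add (hint2.add hint) hint4
    have h3 := circleIntegral.integral_add hint2 hint
    simp only [Pi.add_apply] at h2
    rw [hK, h1, h2, h3, circleIntegral.integral_smul, circleIntegral.integral_smul_const, circleIntegral.integral_sub_center_inv c hr.ne',
      smul_add, smul_add, smul_smul, hk, inv_mul_cancel₀ Complex.two_pi_I_ne_zero, one_smul,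
      rieszProjection, hS, smul_comm (c - w)]
    abel
  refine ⟨S, fun f => ?_⟩
  have hf : S f = R (K f) := by rw [hSK]; rfl
  obtain ⟨h, h'⟩ := hR.1 (K f)
  refine ⟨hf ▸ h, ?_⟩
  have h3 : A ⟨S f, hf ▸ h⟩ = K f + w • S f := by
    simp only [hf]
    exact (eq_add_of_sub_eq h')
  rw [h3, hKS]
  simp
  module

end Riesz

/-- At an isolated semisimple eigenvalue of finite multiplicity, `A - c` has a bounded right
inverse modulo the eigenspace. -/
theorem IsIsolatedSemisimpleEigenvalue.exists_right_inverse_mod [CompleteSpace H] {c : ℂ} {n : ℕ}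
    (hn : 0 < n) (hc : IsIsolatedSemisimpleEigenvalue A c n) :
    ∃ S : H →L[ℂ] H, ∀ f, ∃ h : S f ∈ A.domain,
      f - (A ⟨S f, h⟩ - c • S f) ∈ eigenspace A c := by
  obtain ⟨-, hgeom, r, hr, hres, halg⟩ := hc
  have hres' : Metric.sphere c r ⊆ resolventSet A := by
    intro z hz
    rw [mem_sphere_iff_norm] at hz
    exact hres z (hz ▸ hr) hz.le
  have hle : eigenspace A c ≤ LinearMap.range (rieszProjection A c r : H →ₗ[ℂ] H) := fun u hu =>
    ⟨u, rieszProjection_apply_eigenvector hr hres' hu⟩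
  have : FiniteDimensional ℂ (LinearMap.range (rieszProjection A c r : H →ₗ[ℂ] H)) :=
    Module.finite_of_finrank_pos (by rw [halg]; exact hn)
  -- Semisimplicity enters here: equal multiplicities leave no generalized eigenvectors outside the
  -- eigenspace.
  have heq := Submodule.eq_of_le_of_finrank_eq hle (hgeom.trans halg.symm)
  obtain ⟨S, hS⟩ := exists_reduced_resolvent hr hres'
  refine ⟨S, fun f => ?_⟩
  obtain ⟨h, hf⟩ := hS f
  refine ⟨h, ?_⟩
  rw [hf, sub_sub_cancel, heq]
  exact ⟨f, rfl⟩

end Resolvent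

/-! ### Lyapunov–Schmidt reduction to the secular matrix. -/

section Reduction

open scoped InnerProductSpace

variable {H : Type*} [NormedAddCommGroup H] [InnerProductSpace ℂ H]
  {D : Submodule ℂ H} {A B : D →ₗ[ℂ] H} {c : ℂ} {e : Fin 2 → D} {e' : Fin 2 → H} {S T : H →L[ℂ] H}

/-- `S` is the reduced resolvent of `A` at the eigenvalue `c` with eigenvectors `e` and dual
system `e'`, and `T = B S`. -/
structure IsReducedResolvent (A B : D →ₗ[ℂ] H) (c : ℂ) (e : Fin 2 → D) (e' : Fin 2 → H)
    (S T : H →L[ℂ] H) : Prop where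
  eigen : ∀ j, A (e j) = c • (e j : H)
  dual : ∀ j k, ⟪e' j, (e k : H)⟫_ℂ = if j = k then 1 else 0
  mem : ∀ f, S f ∈ D
  right_inv : ∀ f, A ⟨S f, mem f⟩ - c • S f = f - ∑ k, ⟪e' k, f⟫_ℂ • (e k : H)
  comp : ∀ f, B ⟨S f, mem f⟩ = T f
  apply_eigen : ∀ j, S (e j) = 0
  inner_dual : ∀ k f, ⟪e' k, S f⟫_ℂ = 0

/-- Closed graph theorem: for $v$ in the dense domain, $(BSf|v)=(Sf|JBJv)$ is continuous in $f$,
which identifies any limit of $BSf_n$. -/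
theorem exists_clm_eq_comp [CompleteSpace H] (J : H ≃ₗᵢ[ℂ] H) (hJ : ∀ u, J (J u) = u)
    (hD : Dense (D : Set H)) (hJD : ∀ u ∈ D, J u ∈ D)
    (hB : ∀ u x : D, ⟪J (B u), (x : H)⟫_ℂ = ⟪J u, B x⟫_ℂ)
    (S : H →L[ℂ] H) (hS : ∀ f, S f ∈ D) : ∃ T : H →L[ℂ] H, ∀ f, B ⟨S f, hS f⟩ = T f := by
  let T₀ : H →ₗ[ℂ] H := B ∘ₗ (S : H →ₗ[ℂ] H).codRestrict D hS
  have hT₀ : ∀ f, T₀ f = B ⟨S f, hS f⟩ := fun f => rfl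
  have hcont : Continuous T₀ := by
    refine T₀.continuous_of_seq_closed_graph fun x f g hx hg => ?_
    refine hD.eq_of_inner_right ℂ fun v hv => ?_
    have hadj : ∀ f, ⟪v, T₀ f⟫_ℂ = ⟪J (B ⟨J v, hJD v hv⟩), S f⟫_ℂ := by
      intro f
      have := hB ⟨J v, hJD v hv⟩ ⟨S f, hS f⟩
      simp only [hJ] at this
      rw [hT₀, this]
    have h1 : Filter.Tendsto (fun n => ⟪v, T₀ (x n)⟫_ℂ) Filter.atTop (nhds ⟪v, g⟫_ℂ) :=
      Filter.Tendsto.inner tendsto_const_nhds hg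
    have h2 : Filter.Tendsto (fun n => ⟪v, T₀ (x n)⟫_ℂ) Filter.atTop (nhds ⟪v, T₀ f⟫_ℂ) := by
      simp only [hadj]
      exact Filter.Tendsto.inner tendsto_const_nhds ((S.continuous.tendsto f).comp hx)
    exact tendsto_nhds_unique h1 h2
  exact ⟨⟨T₀, hcont⟩, fun f => rfl⟩

theorem exists_isReducedResolvent [CompleteSpace H] (J : H ≃ₗᵢ[ℂ] H) (hJ : ∀ u, J (J u) = u)
    (hD : Dense (D : Set H)) (hJD : ∀ u ∈ D, J u ∈ D)
    (hA : ∀ u x : D, ⟪J (A u), (x : H)⟫_ℂ = ⟪J u, A x⟫_ℂ)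
    (hB : ∀ u x : D, ⟪J (B u), (x : H)⟫_ℂ = ⟪J u, B x⟫_ℂ)
    {lam : ℝ} (he : ∀ j, A (e j) = (lam : ℂ) • (e j : H))
    (hdual : ∀ j k, ⟪e' j, (e k : H)⟫_ℂ = if j = k then 1 else 0)
    {τ : Fin 2 → ℝ} (he' : ∀ k, e' k = (τ k : ℂ) • J (e k)) {S₀ : H →L[ℂ] H}
    (hS₀ : ∀ f, ∃ h : S₀ f ∈ D,
      f - (A ⟨S₀ f, h⟩ - (lam : ℂ) • S₀ f) ∈ Submodule.span ℂ (Set.range fun j => (e j : H))) :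
    ∃ S T : H →L[ℂ] H, IsReducedResolvent A B (lam : ℂ) e e' S T := by
  let Q : H →L[ℂ] H := ∑ k, (innerSL ℂ (e' k)).smulRight (e k : H)
  have hQ : ∀ f, Q f = ∑ k, ⟪e' k, f⟫_ℂ • (e k : H) := fun f => by simp [Q]
  have hQD : ∀ f, Q f ∈ D := fun f => by
    rw [hQ]
    exact D.sum_mem fun k _ => D.smul_mem _ (e k).2
  have hQA : ∀ f, A ⟨Q f, hQD f⟩ = (lam : ℂ) • Q f := by
    intro f
    have : (⟨Q f, hQD f⟩ : D) = ∑ k, ⟪e' k, f⟫_ℂ • e k := Subtype.ext (by simp [hQ])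
    rw [this, hQ, map_sum, Finset.smul_sum]
    refine Finset.sum_congr rfl fun k _ => ?_
    rw [map_smul, he, smul_comm]
  have hdQ : ∀ k f, ⟪e' k, Q f⟫_ℂ = ⟪e' k, f⟫_ℂ := by
    intro k f
    rw [hQ, inner_sum]
    simp [inner_smul_right, hdual]
  have hQe : ∀ j, Q (e j) = e j := by
    intro j
    rw [hQ]
    simp [hdual]
  have hQspan : ∀ w ∈ Submodule.span ℂ (Set.range fun j => (e j : H)), Q w = w := by
    intro w hw
    induction hw using Submodule.span_induction with
    | mem x hx =>
      obtain ⟨j, rfl⟩ := hx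
      exact hQe j
    | zero => simp
    | add x y _ _ hx hy => rw [map_add, hx, hy]
    | smul a x _ hx => rw [map_smul, hx]
  choose hmem₀ hspan using hS₀
  -- `Q` projects onto the span of `e` along the kernel of the dual system; compressing by `1 - Q`
  -- on both sides normalizes the inverse.
  let S : H →L[ℂ] H := (1 - Q) * S₀ * (1 - Q)
  have hS : ∀ f, S f = S₀ (f - Q f) - Q (S₀ (f - Q f)) := fun f => by simp [S]
  have hSD : ∀ f, S f ∈ D := fun f => by
    rw [hS]
    exact D.sub_mem (hmem₀ _) (hQD _)
  -- Since `lam` is real, $J$-symmetry makes $Je_k$ an eigenvector of the adjoint, hence orthogonal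
  -- to the range of `A - lam`.
  have hperp : ∀ k (v : D), ⟪e' k, A v - (lam : ℂ) • (v : H)⟫_ℂ = 0 := by
    intro k v
    rw [he', inner_smul_left, inner_sub_right, ← hA, he, map_smul, inner_smul_left,
      inner_smul_right]
    simp
  obtain ⟨T, hT⟩ := exists_clm_eq_comp J hJ hD hJD hB S hSD
  refine ⟨S, T, ⟨he, hdual, hSD, fun f => ?_, hT, fun j => ?_, fun k f => ?_⟩⟩
  · set g := f - Q f with hg
    have h1 : A ⟨S f, hSD f⟩ - (lam : ℂ) • S f = A ⟨S₀ g, hmem₀ g⟩ - (lam : ℂ) • S₀ g := by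
      have : (⟨S f, hSD f⟩ : D) = ⟨S₀ g, hmem₀ g⟩ - ⟨Q (S₀ g), hQD _⟩ := Subtype.ext (hS f)
      rw [this, map_sub, hQA, hS, smul_sub]
      abel
    have h2 := hQspan _ (hspan g)
    -- The remainder lies in the span, so `Q` fixes it; but `Q` kills both `g` and the range of `A -
    -- lam`. Hence the remainder is zero.
    have h3 : Q (g - (A ⟨S₀ g, hmem₀ g⟩ - (lam : ℂ) • S₀ g)) = 0 := by
      rw [hQ]
      refine Finset.sum_eq_zero fun k _ => ?_
      rw [inner_sub_right, hperp k ⟨S₀ g, hmem₀ g⟩, hg, inner_sub_right, hdQ]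
      simp
    rw [h1, ← hQ, ← hg]
    exact (sub_eq_zero.1 (h2.symm.trans h3)).symm
  · rw [hS, hQe, sub_self, map_zero, map_zero, sub_zero]
  · rw [hS, inner_sub_right, hdQ, sub_self]

/-- The vectors `(1 - μ S + ε T)⁻¹ B e_j` at `p = (μ, ε)`. -/
noncomputable def corrector (B : D →ₗ[ℂ] H) (e : Fin 2 → D) (S T : H →L[ℂ] H) (p : ℂ × ℂ) (j : Fin 2) : H :=
  Ring.inverse (1 - (p.1 • S - p.2 • T)) (B (e j))

/-- The effective perturbation matrix at `p = (μ, ε)`. -/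
noncomputable def effMatrix (B : D →ₗ[ℂ] H) (e : Fin 2 → D) (e' : Fin 2 → H) (S T : H →L[ℂ] H) (p : ℂ × ℂ) :
    Matrix (Fin 2) (Fin 2) ℂ :=
  Matrix.of fun j k => ⟪e' k, corrector B e S T p j⟫_ℂ

/-- `c + μ` is an eigenvalue of `A + ε B` when this matrix is singular, `p = (μ, ε)`. -/
noncomputable def secularMatrix (B : D →ₗ[ℂ] H) (e : Fin 2 → D) (e' : Fin 2 → H) (S T : H →L[ℂ] H) (p : ℂ × ℂ) :
    Matrix (Fin 2) (Fin 2) ℂ :=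
  p.2 • effMatrix B e e' S T p - p.1 • 1

namespace IsReducedResolvent

/-- With $u=e_j-\epsilon Sg$, the residual is $-\epsilon(g-Be_j-\mu Sg+\epsilon Tg)$ plus a vector
of the eigenspace; `corrector` is the $g$ that makes the bracket vanish. -/
theorem exists_approx_eigenvector (hS : IsReducedResolvent A B c e e' S T) {p : ℂ × ℂ}
    (hp : IsUnit (1 - (p.1 • S - p.2 • T))) (j : Fin 2) :
    ∃ u : D, (A u + p.2 • B u - (c + p.1) • (u : H) =
        ∑ k, secularMatrix B e e' S T p j k • (e k : H)) ∧
      ∀ k, ⟪e' k, (u : H)⟫_ℂ = if k = j then 1 else 0 := by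
  set g := corrector B e S T p j with hg
  have hg1 : g = B (e j) + p.1 • S g - p.2 • T g := by
    have h1 : (1 - (p.1 • S - p.2 • T)) g = B (e j) := by
      rw [hg, corrector, ← mul_apply_eq_comp, Ring.mul_inverse_cancel _ hp,
        one_apply_eq_self]
    rw [← h1]
    simp
    abel
  refine ⟨e j - p.2 • ⟨S g, hS.mem g⟩, ?_, fun k => ?_⟩
  · have hAS := sub_eq_iff_eq_add.1 (hS.right_inv g)
    have hM : ∑ k, secularMatrix B e e' S T p j k • (e k : H) =
        p.2 • ∑ k, ⟪e' k, g⟫_ℂ • (e k : H) - p.1 • (e j : H) := by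
      simp only [secularMatrix, effMatrix, Matrix.sub_apply, Matrix.smul_apply, Matrix.of_apply,
        Matrix.one_apply, sub_smul, Finset.sum_sub_distrib, Finset.smul_sum, smul_eq_mul, mul_smul,
        ← hg]
      simp
    simp only [map_sub, map_smul, hAS, hS.comp, hS.eigen, hM, Submodule.coe_sub, Submodule.coe_smul]
    have h0 := sub_eq_zero.2 hg1
    have h2 : p.2 • (g - (B (e j) + p.1 • S g - p.2 • T g)) = 0 := by rw [h0, smul_zero]
    rw [← sub_eq_zero]
    rw [← neg_eq_zero, ← h2]
    module
  · rw [Submodule.coe_sub, Submodule.coe_smul, inner_sub_right, inner_smul_right, hS.inner_dual,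
      hS.dual]
    simp

/-- A null vector of the secular matrix yields an eigenvector with prescribed coordinates. -/
theorem exists_eigenvector (hS : IsReducedResolvent A B c e e' S T) {p : ℂ × ℂ}
    (hp : IsUnit (1 - (p.1 • S - p.2 • T))) {v : Fin 2 → ℂ}
    (hv : Matrix.vecMul v (secularMatrix B e e' S T p) = 0) :
    ∃ u : D, A u + p.2 • B u = (c + p.1) • (u : H) ∧ ∀ k, ⟪e' k, (u : H)⟫_ℂ = v k := by
  choose u hu hdual using hS.exists_approx_eigenvector hp
  refine ⟨∑ j, v j • u j, ?_, fun k => ?_⟩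
  · rw [← sub_eq_zero]
    have h1 : A (∑ j, v j • u j) + p.2 • B (∑ j, v j • u j) -
        (c + p.1) • ((∑ j, v j • u j : D) : H) =
        ∑ j, v j • (A (u j) + p.2 • B (u j) - (c + p.1) • (u j : H)) := by
      simp only [Fin.sum_univ_two, map_add, map_smul, Submodule.coe_add, Submodule.coe_smul]
      module
    rw [h1]
    simp only [hu, Finset.smul_sum, smul_smul]
    rw [Finset.sum_comm]
    refine Finset.sum_eq_zero fun k _ => ?_
    rw [← Finset.sum_smul]
    have h2 := congrFun hv k
    rw [Matrix.vecMul, dotProduct] at h2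
    rw [h2, Pi.zero_apply, zero_smul]
  · simp [inner_add_right, inner_smul_right, hdual, Fin.sum_univ_two]
    fin_cases k <;> simp

/-- The symmetry of the secular matrix inherited from the `J`-selfadjointness of `A` and `B`. -/
theorem secularMatrix_symm {lam : ℝ} (hS : IsReducedResolvent A B (lam : ℂ) e e' S T)
    (J : H ≃ₗᵢ[ℂ] H) (hJ : ∀ u, J (J u) = u)
    (hA : ∀ u x : D, ⟪J (A u), (x : H)⟫_ℂ = ⟪J u, A x⟫_ℂ)
    (hB : ∀ u x : D, ⟪J (B u), (x : H)⟫_ℂ = ⟪J u, B x⟫_ℂ)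
    {τ : Fin 2 → ℝ} (hJe : ∀ k, J (e k) = (τ k : ℂ) • e' k) {μ : ℂ} {ε : ℝ}
    (h1 : IsUnit (1 - (μ • S - (ε : ℂ) • T))) (h2 : IsUnit (1 - (conj μ • S - (ε : ℂ) • T)))
    (j k : Fin 2) :
    τ j * secularMatrix B e e' S T (conj μ, (ε : ℂ)) k j =
      τ k * conj (secularMatrix B e e' S T (μ, (ε : ℂ)) j k) := by
  obtain ⟨u, hu, hud⟩ := hS.exists_approx_eigenvector (p := (μ, (ε : ℂ))) h1 j
  obtain ⟨x, hx, hxd⟩ := hS.exists_approx_eigenvector (p := (conj μ, (ε : ℂ))) h2 k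
  have hJsymm : ∀ a b : H, ⟪J a, b⟫_ℂ = ⟪a, J b⟫_ℂ := by
    intro a b
    rw [← J.inner_map_map, hJ]
  -- Both residuals lie in the span of `e`, and the normalized dual coordinates of `u` and `x` pick
  -- one matrix entry from each side.
  have key : ⟪J (A u + (ε : ℂ) • B u - ((lam : ℂ) + μ) • (u : H)), (x : H)⟫_ℂ =
      ⟪J u, A x + (ε : ℂ) • B x - ((lam : ℂ) + conj μ) • (x : H)⟫_ℂ := by
    simp only [map_add, map_sub, map_smul, inner_add_left, inner_sub_left, inner_smul_left,
      inner_add_right, inner_sub_right, inner_smul_right, hA, hB, Complex.conj_ofReal]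
  simp only at hu hx
  rw [hu, hx, map_sum, sum_inner, inner_sum] at key
  have hl : ∀ m, ⟪J (secularMatrix B e e' S T (μ, (ε : ℂ)) j m • (e m : H)), (x : H)⟫_ℂ =
      if m = k then τ m * conj (secularMatrix B e e' S T (μ, (ε : ℂ)) j m) else 0 := by
    intro m
    rw [map_smul, inner_smul_left, hJe, inner_smul_left, hxd, Complex.conj_ofReal]
    split_ifs <;> ring
  have hr : ∀ m, ⟪J u, secularMatrix B e e' S T (conj μ, (ε : ℂ)) k m • (e m : H)⟫_ℂ =
      if m = j then τ m * secularMatrix B e e' S T (conj μ, (ε : ℂ)) k m else 0 := by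
    intro m
    rw [inner_smul_right, hJsymm, hJe, inner_smul_right, ← inner_conj_symm, hud]
    split_ifs <;> simp
    ring
  simp only [hl, hr, Finset.sum_ite_eq', Finset.mem_univ, if_true] at key
  exact key.symm

end IsReducedResolvent

theorem effMatrix_zero (j k : Fin 2) : effMatrix B e e' S T 0 j k = ⟪e' k, B (e j)⟫_ℂ := by
  simp [effMatrix, corrector]

theorem contDiffAt_effMatrix [CompleteSpace H] {p : ℂ × ℂ}
    (hp : IsUnit (1 - (p.1 • S - p.2 • T))) (j k : Fin 2) :
    ContDiffAt ℂ 1 (fun p => effMatrix B e e' S T p j k) p := by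
  have h1 : ContDiffAt ℂ 1 (fun p : ℂ × ℂ => Ring.inverse (1 - (p.1 • S - p.2 • T))) p := by
    refine ContDiffAt.comp p (g := Ring.inverse) ?_ (by fun_prop)
    obtain ⟨u, hu⟩ := hp
    rw [← hu]
    exact contDiffAt_ringInverse ℂ u
  have h2 : ContDiffAt ℂ 1
      (fun p : ℂ × ℂ => Ring.inverse (1 - (p.1 • S - p.2 • T)) (B (e j))) p :=
    h1.clm_apply contDiffAt_const
  exact ((innerSL ℂ (e' k)).contDiff.contDiffAt).comp p h2

theorem exists_ball_isUnit [CompleteSpace H] (S T : H →L[ℂ] H) :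
    ∃ ρ : ℝ, 0 < ρ ∧ ∀ p : ℂ × ℂ, ‖p.1‖ ≤ ρ → ‖p.2‖ ≤ ρ → IsUnit (1 - (p.1 • S - p.2 • T)) := by
  have hc : ContinuousAt (fun p : ℂ × ℂ => 1 - (p.1 • S - p.2 • T)) 0 := by fun_prop
  have hev : ∀ᶠ p : ℂ × ℂ in nhds 0, IsUnit (1 - (p.1 • S - p.2 • T)) := by
    apply hc.eventually
    simpa [Filter.Eventually] using Units.nhds (1 : (H →L[ℂ] H)ˣ)
  obtain ⟨r, hr, hball⟩ := Metric.eventually_nhds_iff_ball.1 hev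
  refine ⟨r / 2, by positivity, fun p h1 h2 => hball p ?_⟩
  rw [mem_ball_zero_iff, Prod.norm_def]
  exact (max_le h1 h2).trans_lt (by linarith)

end Reduction

/-! ### Root finding: intermediate values and the implicit function theorem. -/

/-- The fixed points of the two eigenvalue branches of a continuous family of Hermitian matrices
with diagonal `a, d` and off-diagonal entry `b`. -/
theorem exists_real_roots {ρ : ℝ} {a d b : ℝ → ℝ} (hρ : 0 < ρ)
    (ha : ContinuousOn a (Set.Icc (-ρ) ρ)) (hd : ContinuousOn d (Set.Icc (-ρ) ρ))
    (hb : ContinuousOn b (Set.Icc (-ρ) ρ))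
    (ha' : ∀ μ ∈ Set.Icc (-ρ) ρ, |a μ| ≤ ρ / 2) (hd' : ∀ μ ∈ Set.Icc (-ρ) ρ, |d μ| ≤ ρ / 2)
    (hb' : ∀ μ ∈ Set.Icc (-ρ) ρ, |b μ| ≤ ρ / 2) :
    ∃ μ : Fin 2 → ℝ, (∀ j, μ j ∈ Set.Icc (-ρ) ρ) ∧
      (∀ j, (a (μ j) - μ j) * (d (μ j) - μ j) = b (μ j) ^ 2) ∧
      (μ 0 = μ 1 → a (μ 0) = μ 0 ∧ d (μ 0) = μ 0 ∧ b (μ 0) = 0) := by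
  let s : ℝ → ℝ := fun μ => Real.sqrt (((a μ - d μ) / 2) ^ 2 + b μ ^ 2)
  have hs : ContinuousOn s (Set.Icc (-ρ) ρ) := by
    apply Real.continuous_sqrt.comp_continuousOn
    fun_prop
  have hs2 : ∀ μ, s μ ^ 2 = ((a μ - d μ) / 2) ^ 2 + b μ ^ 2 := fun μ =>
    Real.sq_sqrt (by positivity)
  have hs0 : ∀ μ, 0 ≤ s μ := fun μ => Real.sqrt_nonneg _
  have hsle : ∀ μ, s μ ≤ |(a μ - d μ) / 2| + |b μ| := by
    intro μ
    refine Real.sqrt_le_iff.2 ⟨by positivity, ?_⟩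
    have := mul_nonneg (abs_nonneg ((a μ - d μ) / 2)) (abs_nonneg (b μ))
    nlinarith [sq_abs ((a μ - d μ) / 2), sq_abs (b μ)]
  -- Each branch maps $[-\rho,\rho]$ into itself: $|a+d|/2+|a-d|/2=\max(|a|,|d|)\le\rho/2$, and
  -- $|b|$ adds at most $\rho/2$.
  have branch : ∀ σ : ℝ, |σ| = 1 → ∃ μ ∈ Set.Icc (-ρ) ρ, (a μ + d μ) / 2 + σ * s μ = μ := by
    intro σ hσ
    have hbd : ∀ μ ∈ Set.Icc (-ρ) ρ, |(a μ + d μ) / 2 + σ * s μ| ≤ ρ := by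
      intro μ hμ
      have h1 := abs_add_le ((a μ + d μ) / 2) (σ * s μ)
      rw [abs_mul, hσ, one_mul, abs_of_nonneg (hs0 μ)] at h1
      have h2 := hsle μ
      have h3 : |(a μ + d μ) / 2| + |(a μ - d μ) / 2| ≤ ρ / 2 := by
        have := abs_le.1 (ha' μ hμ)
        have := abs_le.1 (hd' μ hμ)
        rcases abs_cases ((a μ + d μ) / 2) with h | h <;>
          rcases abs_cases ((a μ - d μ) / 2) with h' | h' <;> linarith
      have := hb' μ hμ
      linarith
    have hcont : ContinuousOn (fun μ => μ - ((a μ + d μ) / 2 + σ * s μ)) (Set.Icc (-ρ) ρ) := by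
      fun_prop
    have hle : -ρ ≤ ρ := by linarith
    have h1 := abs_le.1 (hbd (-ρ) (Set.left_mem_Icc.2 hle))
    have h2 := abs_le.1 (hbd ρ (Set.right_mem_Icc.2 hle))
    obtain ⟨μ, hμ, h⟩ := intermediate_value_Icc hle hcont
      (show (0 : ℝ) ∈ Set.Icc _ _ from ⟨by linarith, by linarith⟩)
    exact ⟨μ, hμ, (sub_eq_zero.1 h).symm⟩
  obtain ⟨μ₁, hm₁, h₁⟩ := branch 1 (by simp)
  obtain ⟨μ₂, hm₂, h₂⟩ := branch (-1) (by simp)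
  refine ⟨![μ₁, μ₂], ?_, ?_, ?_⟩
  · simp [Fin.forall_fin_two, hm₁.1, hm₁.2, hm₂.1, hm₂.2]
  · simp only [Fin.forall_fin_two, Matrix.cons_val_zero, Matrix.cons_val_one]
    have e₁ : s μ₁ = μ₁ - (a μ₁ + d μ₁) / 2 := by linarith
    have e₂ : s μ₂ = (a μ₂ + d μ₂) / 2 - μ₂ := by linarith
    have f₁ := hs2 μ₁
    have f₂ := hs2 μ₂
    rw [e₁] at f₁
    rw [e₂] at f₂
    constructor <;> linarith
  · simp only [Matrix.cons_val_zero, Matrix.cons_val_one]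
    rintro rfl
    -- A common fixed point of both branches forces the square root to vanish, so the matrix is
    -- scalar there.
    have hz : s μ₁ = 0 := by linarith
    have f₁ := hs2 μ₁
    rw [hz] at f₁ h₁
    have g₁ : (a μ₁ - d μ₁) / 2 = 0 := by
      apply pow_eq_zero_iff two_ne_zero |>.1
      nlinarith [sq_nonneg ((a μ₁ - d μ₁) / 2), sq_nonneg (b μ₁)]
    have g₂ : b μ₁ = 0 := by
      apply pow_eq_zero_iff two_ne_zero |>.1
      nlinarith [sq_nonneg ((a μ₁ - d μ₁) / 2), sq_nonneg (b μ₁)]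
    exact ⟨by linarith, by linarith, g₂⟩

/-- Persistence of a simple zero under perturbation. -/
theorem exists_tendsto_zero_of_hasDerivAt {f : ℂ × ℂ → ℂ} {s₀ d : ℂ}
    (hf : ContDiffAt ℂ 1 f (0, s₀)) (h0 : f (0, s₀) = 0)
    (hd : HasDerivAt (fun s => f (0, s)) d s₀) (hd0 : d ≠ 0) :
    ∃ ψ : ℂ → ℂ, Filter.Tendsto ψ (nhds 0) (nhds s₀) ∧ ∀ᶠ ε in nhds 0, f (ε, ψ ε) = 0 := by
  have hstrict := hf.hasStrictFDerivAt one_ne_zero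
  have hpart : fderiv ℂ f (0, s₀) ∘L .inr ℂ ℂ ℂ = ContinuousLinearMap.toSpanSingleton ℂ d := by
    refine HasFDerivAt.unique (f := fun s => f (0, s)) (x := s₀) ?_ hd.hasFDerivAt
    exact HasFDerivAt.comp s₀ hstrict.hasFDerivAt (hasFDerivAt_prodMk_right 0 s₀)
  have hinv : (fderiv ℂ f (0, s₀) ∘L .inr ℂ ℂ ℂ).IsInvertible := by
    rw [hpart]
    refine ⟨ContinuousLinearEquiv.unitsEquivAut ℂ (Units.mk0 d hd0), ?_⟩
    ext
    simp
  refine ⟨hstrict.implicitFunctionOfProdDomain hinv,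
    hstrict.tendsto_implicitFunctionOfProdDomain hinv, ?_⟩
  filter_upwards [hstrict.eventually_apply_implicitFunctionOfProdDomain hinv] with ε hε
  rw [hε, h0]

/-! ### Eigenvalues of the perturbed operator in the definite and indefinite cases. -/

section Eigenvalues

open scoped InnerProductSpace

variable {H : Type*} [NormedAddCommGroup H] [InnerProductSpace ℂ H]
  {D : Submodule ℂ H} {A B : D →ₗ[ℂ] H} {e : Fin 2 → D} {e' : Fin 2 → H} {S T : H →L[ℂ] H}

theorem linearIndependent_pair_of_ne {u : Fin 2 → D} {z : Fin 2 → ℂ}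
    (hu : ∀ j, A (u j) = z j • (u j : H)) (h0 : ∀ j, u j ≠ 0) (hz : z 0 ≠ z 1) :
    LinearIndependent ℂ (fun j => (u j : H)) := by
  have key : ∀ s t : ℂ, s • (u 0 : H) + t • (u 1 : H) = 0 → s = 0 ∧ t = 0 := by
    intro s t h
    have hD : s • u 0 + t • u 1 = 0 := Subtype.ext h
    have hA := congrArg A hD
    rw [map_add, map_smul, map_smul, map_zero, hu, hu] at hA
    have hz' : z 0 - z 1 ≠ 0 := sub_ne_zero.2 hz
    have hu0 : ∀ j, (u j : H) ≠ 0 := fun j h => h0 j (Subtype.ext h)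
    have h1 : (s * (z 0 - z 1)) • (u 0 : H) = 0 := by
      calc (s * (z 0 - z 1)) • (u 0 : H)
          = (s • z 0 • (u 0 : H) + t • z 1 • (u 1 : H)) -
            z 1 • (s • (u 0 : H) + t • (u 1 : H)) := by module
        _ = 0 := by rw [hA, h, smul_zero, sub_zero]
    have h2 : (t * (z 0 - z 1)) • (u 1 : H) = 0 := by
      calc (t * (z 0 - z 1)) • (u 1 : H)
          = z 0 • (s • (u 0 : H) + t • (u 1 : H)) -
            (s • z 0 • (u 0 : H) + t • z 1 • (u 1 : H)) := by module
        _ = 0 := by rw [hA, h, smul_zero, sub_zero]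
    simpa [hz', hu0] using And.intro h1 h2
  have hpair : (fun j => (u j : H)) = ![(u 0 : H), (u 1 : H)] := by
    ext j
    fin_cases j <;> rfl
  rw [hpair]
  exact LinearIndependent.pair_iff.2 key

theorem linearIndependent_of_dual {u : Fin 2 → H}
    (h : ∀ j k, ⟪e' k, u j⟫_ℂ = if k = j then 1 else 0) : LinearIndependent ℂ u := by
  rw [Fintype.linearIndependent_iff]
  intro g hg k
  have := congrArg (fun x => ⟪e' k, x⟫_ℂ) hg
  fin_cases k <;> simpa [inner_sum, inner_smul_right, h] using this

theorem inner_dual_perturbation_symm (J : H ≃ₗᵢ[ℂ] H) (hJ : ∀ u, J (J u) = u)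
    (hB : ∀ u x : D, ⟪J (B u), (x : H)⟫_ℂ = ⟪J u, B x⟫_ℂ)
    {τ : Fin 2 → ℝ} (hJe : ∀ k, J (e k) = (τ k : ℂ) • e' k) (j k : Fin 2) :
    τ j * ⟪e' j, B (e k)⟫_ℂ = τ k * conj ⟪e' k, B (e j)⟫_ℂ := by
  have h := hB (e j) (e k)
  rw [← J.inner_map_map, hJ, hJe, hJe, inner_smul_left, inner_smul_right,
    ← inner_conj_symm (B (e j))] at h
  simpa using h.symm

variable {lam : ℝ}

theorem secularMatrix_apply (p : ℂ × ℂ) (j k : Fin 2) :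
    secularMatrix B e e' S T p j k =
      p.2 * effMatrix B e e' S T p j k - if j = k then p.1 else 0 := by
  simp [secularMatrix, Matrix.one_apply]

namespace IsReducedResolvent

/-- In the definite case the two eigenvalues stay real and semisimple. -/
theorem exists_real_eigenvalues [CompleteSpace H]
    (hS : IsReducedResolvent A B (lam : ℂ) e e' S T)
    (J : H ≃ₗᵢ[ℂ] H) (hJ : ∀ u, J (J u) = u)
    (hA : ∀ u x : D, ⟪J (A u), (x : H)⟫_ℂ = ⟪J u, A x⟫_ℂ)
    (hB : ∀ u x : D, ⟪J (B u), (x : H)⟫_ℂ = ⟪J u, B x⟫_ℂ)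
    {τ : Fin 2 → ℝ} (hJe : ∀ k, J (e k) = (τ k : ℂ) • e' k) (hτ : τ 0 * τ 1 = 1)
    (hττ : τ 0 = τ 1) {δ : ℝ} (hδ : 0 < δ) :
    ∃ εs : ℝ, 0 < εs ∧ ∀ ε : ℝ, |ε| < εs → ∃ (μ : Fin 2 → ℝ) (u : Fin 2 → D),
      LinearIndependent ℂ (fun j => (u j : H)) ∧ ∀ j, |μ j| < δ ∧
        A (u j) + (ε : ℂ) • B (u j) = ((lam : ℂ) + μ j) • (u j : H) := by
  obtain ⟨ρ₀, hρ₀, hunit⟩ := exists_ball_isUnit S T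
  have hτ0 : (τ 0 : ℂ) ≠ 0 := by
    intro h
    rw [Complex.ofReal_eq_zero.1 h] at hτ
    simp at hτ
  have hbdd : ∃ C : ℝ, 0 < C ∧ ∃ r > 0, ∀ p : ℂ × ℂ, ‖p.1‖ ≤ r → ‖p.2‖ ≤ r → ∀ j k,
      ‖effMatrix B e e' S T p j k‖ ≤ C := by
    set C : ℝ := ∑ j, ∑ k, ‖effMatrix B e e' S T 0 j k‖ + 1 with hC
    have hlt : ∀ j k, ‖effMatrix B e e' S T 0 j k‖ < C := by
      intro j k
      have h1 : _ ≤ ∑ k, ‖effMatrix B e e' S T 0 j k‖ := Finset.single_le_sum (f := fun k => ‖effMatrix B e e' S T 0 j k‖)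
        (fun k _ => norm_nonneg _) (Finset.mem_univ k)
      have h2 : _ ≤ ∑ j, ∑ k, ‖effMatrix B e e' S T 0 j k‖ := Finset.single_le_sum (f := fun j => ∑ k, ‖effMatrix B e e' S T 0 j k‖)
        (fun j _ => Finset.sum_nonneg fun k _ => norm_nonneg _) (Finset.mem_univ j)
      linarith
    have hev : ∀ᶠ p : ℂ × ℂ in nhds 0, ∀ j k, ‖effMatrix B e e' S T p j k‖ < C := by
      refine Filter.eventually_all.2 fun j => Filter.eventually_all.2 fun k => ?_
      have hu : IsUnit (1 - ((0 : ℂ × ℂ).1 • S - (0 : ℂ × ℂ).2 • T)) := by simp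
      exact (contDiffAt_effMatrix hu j k).continuousAt.norm.eventually_lt_const (hlt j k)
    obtain ⟨r, hr, hball⟩ := Metric.eventually_nhds_iff_ball.1 hev
    refine ⟨C, (norm_nonneg _).trans_lt (hlt 0 0), r / 2, by positivity, fun p h1 h2 j k => ?_⟩
    refine (hball p ?_ j k).le
    rw [mem_ball_zero_iff, Prod.norm_def]
    exact (max_le h1 h2).trans_lt (by linarith)
  obtain ⟨C, hC, r, hr, hbound⟩ := hbdd
  obtain ⟨ρ, hρ, hρ1, hρ2, hρ3⟩ : ∃ ρ : ℝ, 0 < ρ ∧ ρ ≤ ρ₀ ∧ ρ ≤ r ∧ ρ < δ := by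
    refine ⟨min (min ρ₀ r) (δ / 2), by positivity, ?_, ?_, ?_⟩
    · exact (min_le_left _ _).trans (min_le_left _ _)
    · exact (min_le_left _ _).trans (min_le_right _ _)
    · exact (min_le_right _ _).trans_lt (by linarith)
  -- The second bound gives $|\epsilon|C\le\rho/2$, the entry bound that `exists_real_roots` needs.
  refine ⟨min ρ (ρ / (2 * C)), by positivity, fun ε hε => ?_⟩
  have hε1 : ‖(ε : ℂ)‖ ≤ ρ := by
    rw [Complex.norm_real]
    exact (hε.trans_le (min_le_left _ _)).le
  have hε2 : ‖(ε : ℂ)‖ * C ≤ ρ / 2 := by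
    rw [Complex.norm_real, Real.norm_eq_abs]
    have h := (hε.trans_le (min_le_right _ _)).le
    rw [le_div_iff₀ (by positivity)] at h
    linarith
  have hμ : ∀ μ ∈ Set.Icc (-ρ) ρ, ‖(μ : ℂ)‖ ≤ ρ := by
    intro μ hμ
    rw [Complex.norm_real]
    exact abs_le.2 hμ
  have hU : ∀ μ ∈ Set.Icc (-ρ) ρ, IsUnit (1 - ((μ : ℂ) • S - (ε : ℂ) • T)) := fun μ h =>
    hunit (μ, ε) ((hμ μ h).trans hρ1) (hε1.trans hρ1)
  let W : ℝ → Fin 2 → Fin 2 → ℂ := fun μ j k => ε * effMatrix B e e' S T (μ, ε) j k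
  have hWc : ∀ j k, ContinuousOn (fun μ => W μ j k) (Set.Icc (-ρ) ρ) := by
    intro j k μ h
    refine ContinuousAt.continuousWithinAt (continuousAt_const.mul ?_)
    have h1 : ContinuousAt (fun μ : ℝ => ((μ : ℂ), (ε : ℂ))) μ := by fun_prop
    exact ContinuousAt.comp (f := fun μ : ℝ => ((μ : ℂ), (ε : ℂ)))
      (contDiffAt_effMatrix (p := ((μ : ℂ), (ε : ℂ))) (hU μ h) j k).continuousAt h1
  have hWb : ∀ μ ∈ Set.Icc (-ρ) ρ, ∀ j k, ‖W μ j k‖ ≤ ρ / 2 := by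
    intro μ h j k
    rw [norm_mul]
    refine (mul_le_mul_of_nonneg_left ?_ (norm_nonneg _)).trans hε2
    exact hbound (μ, ε) ((hμ μ h).trans hρ2) (hε1.trans hρ2) j k
  -- The equal signs cancel from the $J$-symmetry, leaving a Hermitian matrix for real $\mu$.
  have hsymm : ∀ μ ∈ Set.Icc (-ρ) ρ, ∀ j k, W μ k j = conj (W μ j k) := by
    intro μ h j k
    have hs := hS.secularMatrix_symm J hJ hA hB hJe (μ := (μ : ℂ)) (ε := ε) (hU μ h)
      (by rw [Complex.conj_ofReal]; exact hU μ h) j k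
    have hτjk : τ j = τ 0 ∧ τ k = τ 0 := by
      constructor
      · fin_cases j <;> simp [hττ]
      · fin_cases k <;> simp [hττ]
    rw [hτjk.1, hτjk.2, Complex.conj_ofReal, secularMatrix_apply, secularMatrix_apply] at hs
    have hs' := mul_left_cancel₀ hτ0 hs
    have hif : conj (if j = k then (μ : ℂ) else 0) = if k = j then (μ : ℂ) else 0 := by
      by_cases hjk : j = k
      · simp [hjk]
      · simp [hjk, Ne.symm hjk]
    rw [map_sub, hif, sub_left_inj] at hs'
    exact hs'
  have hdiag : ∀ μ ∈ Set.Icc (-ρ) ρ, ∀ j, W μ j j = ((W μ j j).re : ℂ) := fun μ h j =>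
    (Complex.conj_eq_iff_re.1 (hsymm μ h j j).symm).symm
  have hM : ∀ μ : ℝ, ∀ j k, secularMatrix B e e' S T ((μ : ℂ), (ε : ℂ)) j k =
      W μ j k - if j = k then (μ : ℂ) else 0 := fun μ j k => secularMatrix_apply _ j k
  obtain ⟨μ, hmem, hroot, heq⟩ := exists_real_roots (a := fun μ => (W μ 0 0).re)
    (d := fun μ => (W μ 1 1).re) (b := fun μ => ‖W μ 0 1‖) hρ
    (Complex.continuous_re.comp_continuousOn (hWc 0 0))
    (Complex.continuous_re.comp_continuousOn (hWc 1 1)) (hWc 0 1).norm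
    (fun μ h => (Complex.abs_re_le_norm _).trans (hWb μ h 0 0))
    (fun μ h => (Complex.abs_re_le_norm _).trans (hWb μ h 1 1))
    (fun μ h => by rw [abs_norm]; exact hWb μ h 0 1)
  have hμδ : ∀ j, |μ j| < δ := fun j => (abs_le.2 (hmem j)).trans_lt hρ3
  -- If the roots coincide, the secular matrix vanishes and both coordinate vectors are null
  -- vectors; otherwise independence comes from distinct eigenvalues.
  by_cases hne : μ 0 = μ 1
  · obtain ⟨h1, h2, h3⟩ := heq hne
    have hzero : secularMatrix B e e' S T ((μ 0 : ℂ), (ε : ℂ)) = 0 := by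
      have h01 : W (μ 0) 0 1 = 0 := norm_eq_zero.1 h3
      have h10 : W (μ 0) 1 0 = 0 := by rw [hsymm _ (hmem 0) 0 1, h01, map_zero]
      ext j k
      rw [hM]
      fin_cases j <;> fin_cases k
      · simpa [h1] using sub_eq_zero.2 (hdiag _ (hmem 0) 0)
      · simp [h01]
      · simp [h10]
      · simpa [h2] using sub_eq_zero.2 (hdiag _ (hmem 0) 1)
    have hex : ∀ j : Fin 2, ∃ u : D,
        A u + (ε : ℂ) • B u = ((lam : ℂ) + μ 0) • (u : H) ∧
          ∀ k, ⟪e' k, (u : H)⟫_ℂ = if k = j then 1 else 0 := fun j =>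
      hS.exists_eigenvector (p := ((μ 0 : ℂ), (ε : ℂ))) (hU _ (hmem 0))
        (v := fun k => if k = j then 1 else 0) (by rw [hzero, Matrix.vecMul_zero])
    choose u hu hud using hex
    refine ⟨fun _ => μ 0, u, linearIndependent_of_dual hud, fun j => ⟨hμδ 0, hu j⟩⟩
  · have hdet : ∀ j, (secularMatrix B e e' S T ((μ j : ℂ), (ε : ℂ))).det = 0 := by
      intro j
      have h1 : (((W (μ j) 0 0).re : ℂ) - μ j) * (((W (μ j) 1 1).re : ℂ) - μ j) =
          (‖W (μ j) 0 1‖ : ℂ) ^ 2 := by exact_mod_cast hroot j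
      rw [← hdiag _ (hmem j), ← hdiag _ (hmem j), ← Complex.mul_conj', ← hsymm _ (hmem j)] at h1
      rw [Matrix.det_fin_two, hM, hM, hM, hM]
      simpa using sub_eq_zero.2 h1
    have hex : ∀ j, ∃ u : D, A u + (ε : ℂ) • B u = ((lam : ℂ) + μ j) • (u : H) ∧ u ≠ 0 := by
      intro j
      obtain ⟨v, hv0, hv⟩ := Matrix.exists_vecMul_eq_zero_iff.2 (hdet j)
      obtain ⟨u, hu, hud⟩ := hS.exists_eigenvector (p := ((μ j : ℂ), (ε : ℂ))) (hU _ (hmem j)) hv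
      refine ⟨u, hu, ?_⟩
      rintro rfl
      exact hv0 (funext fun k => by rw [← hud k]; simp)
    choose u hu hu0 using hex
    refine ⟨μ, u, linearIndependent_pair_of_ne (A := A + (ε : ℂ) • B)
      (z := fun j => (lam : ℂ) + μ j) hu hu0 ?_, fun j => ⟨hμδ j, hu j⟩⟩
    simpa using hne

/-- In the indefinite case with large coupling the double eigenvalue splits into a pair of
non-real conjugate eigenvalues. -/
theorem exists_nonreal_eigenvalues [CompleteSpace H]
    (hS : IsReducedResolvent A B (lam : ℂ) e e' S T)
    (J : H ≃ₗᵢ[ℂ] H) (hJ : ∀ u, J (J u) = u)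
    (hA : ∀ u x : D, ⟪J (A u), (x : H)⟫_ℂ = ⟪J u, A x⟫_ℂ)
    (hB : ∀ u x : D, ⟪J (B u), (x : H)⟫_ℂ = ⟪J u, B x⟫_ℂ)
    {τ : Fin 2 → ℝ} (hJe : ∀ k, J (e k) = (τ k : ℂ) • e' k) (hτ : τ 0 * τ 1 = -1)
    (hττ : τ 1 = -τ 0)
    (hh : ((⟪e' 0, B (e 0)⟫_ℂ).re - (⟪e' 1, B (e 1)⟫_ℂ).re) ^ 2 < 4 * ‖⟪e' 1, B (e 0)⟫_ℂ‖ ^ 2)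
    {δ : ℝ} (hδ : 0 < δ) :
    ∃ εs : ℝ, 0 < εs ∧ ∀ ε : ℝ, 0 < |ε| → |ε| < εs → ∃ μ : ℂ, μ.im ≠ 0 ∧ ‖μ‖ < δ ∧
      (∃ u : D, u ≠ 0 ∧ A u + (ε : ℂ) • B u = ((lam : ℂ) + μ) • (u : H)) ∧
      ∃ u : D, u ≠ 0 ∧ A u + (ε : ℂ) • B u = ((lam : ℂ) + conj μ) • (u : H) := by
  obtain ⟨ρ, hρ, hunit⟩ := exists_ball_isUnit S T
  have hτ0 : (τ 0 : ℂ) ≠ 0 := by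
    intro h
    rw [Complex.ofReal_eq_zero.1 h] at hτ
    simp at hτ
  have hτ1 : (τ 1 : ℂ) ≠ 0 := by rw [hττ]; simpa using hτ0
  have hsym := inner_dual_perturbation_symm J hJ hB hJe
  set a : ℝ := (⟪e' 0, B (e 0)⟫_ℂ).re
  set d : ℝ := (⟪e' 1, B (e 1)⟫_ℂ).re
  set b : ℂ := ⟪e' 1, B (e 0)⟫_ℂ with hb
  have h00 : ⟪e' 0, B (e 0)⟫_ℂ = a :=
    (Complex.conj_eq_iff_re.1 (mul_left_cancel₀ hτ0 (hsym 0 0)).symm).symm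
  have h11 : ⟪e' 1, B (e 1)⟫_ℂ = d :=
    (Complex.conj_eq_iff_re.1 (mul_left_cancel₀ hτ1 (hsym 1 1)).symm).symm
  have h10 : ⟪e' 0, B (e 1)⟫_ℂ = -conj b := by
    have h := hsym 0 1
    rw [← hb, hττ] at h
    apply mul_left_cancel₀ hτ0
    rw [h]
    push_cast
    ring
  set κ : ℝ := Real.sqrt (‖b‖ ^ 2 - ((a - d) / 2) ^ 2) with hκ
  have hκpos : 0 < κ := Real.sqrt_pos.2 (by nlinarith)
  have hκ2 : κ ^ 2 = ‖b‖ ^ 2 - ((a - d) / 2) ^ 2 := Real.sq_sqrt (by nlinarith)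
  -- The upper root of $(a-s)(d-s)+|b|^2$; opposite signs give the plus before $|b|^2$, and the
  -- coupling hypothesis gives $\kappa>0$.
  set s₀ : ℂ := (a + d) / 2 + κ * Complex.I with hs₀
  let V : ℂ × ℂ → Matrix (Fin 2) (Fin 2) ℂ := fun q => effMatrix B e e' S T (q.1 * q.2, q.1)
  -- With $q=(\epsilon,s)$ and $\mu=\epsilon s$, the secular determinant is $\epsilon^2f(q)$; the
  -- rescaling separates the double root $\mu=0$ into simple roots in $s$.
  let f : ℂ × ℂ → ℂ := fun q => (V q 0 0 - q.2) * (V q 1 1 - q.2) - V q 0 1 * V q 1 0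
  have hV : ∀ j k, ContDiffAt ℂ 1 (fun q => V q j k) (0, s₀) := by
    intro j k
    refine ContDiffAt.comp (f := fun q : ℂ × ℂ => (q.1 * q.2, q.1)) (0, s₀)
      (contDiffAt_effMatrix ?_ j k) (by fun_prop)
    simp
  have hf : ContDiffAt ℂ 1 f (0, s₀) :=
    (((hV 0 0).sub contDiffAt_snd).mul ((hV 1 1).sub contDiffAt_snd)).sub
      ((hV 0 1).mul (hV 1 0))
  have hf0 : ∀ s, f (0, s) = (a - s) * (d - s) + b * conj b := by
    intro s
    have h0 : ((0 : ℂ) * s, (0 : ℂ)) = 0 := by simp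
    simp only [f, V, h0, effMatrix_zero, h00, h11, h10, ← hb]
    ring
  have hfs₀ : f (0, s₀) = 0 := by
    have h1 : (κ : ℂ) ^ 2 = (‖b‖ : ℂ) ^ 2 - (((a : ℂ) - d) / 2) ^ 2 := by exact_mod_cast hκ2
    rw [hf0, Complex.mul_conj', hs₀]
    linear_combination (κ : ℂ) ^ 2 * Complex.I_sq - h1
  have hder : HasDerivAt (fun s => f (0, s)) (2 * (κ * Complex.I)) s₀ := by
    simp only [hf0]
    have h1 := (((hasDerivAt_id s₀).const_sub (a : ℂ)).mul
      ((hasDerivAt_id s₀).const_sub (d : ℂ))).add_const (b * conj b)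
    refine h1.congr_deriv ?_
    simp only [id, hs₀]
    ring
  obtain ⟨ψ, hψ, hψ0⟩ := exists_tendsto_zero_of_hasDerivAt hf hfs₀ hder
    (by simp [hκpos.ne'])
  have him : ∀ᶠ ε in nhds (0 : ℂ), 0 < (ψ ε).im := by
    have h1 : Filter.Tendsto (fun ε => (ψ ε).im) (nhds 0) (nhds s₀.im) :=
      (Complex.continuous_im.tendsto _).comp hψ
    refine h1.eventually_const_lt ?_
    have : s₀.im = κ := by simp [hs₀]
    rw [this]
    exact hκpos
  have hsmall : ∀ᶠ ε in nhds (0 : ℂ), ‖ε * ψ ε‖ < min δ ρ := by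
    have h1 : Filter.Tendsto (fun ε => ‖ε * ψ ε‖) (nhds 0) (nhds ‖0 * s₀‖) :=
      (Filter.tendsto_id.mul hψ).norm
    refine h1.eventually_lt_const ?_
    simp [hδ, hρ]
  obtain ⟨r, hr, hball⟩ := Metric.eventually_nhds_iff_ball.1 (hψ0.and (him.and hsmall))
  refine ⟨min r ρ, by positivity, fun ε hε0 hε => ?_⟩
  obtain ⟨h1, h2, h3⟩ := hball (ε : ℂ) (by
    rw [mem_ball_zero_iff, Complex.norm_real]
    exact hε.trans_le (min_le_left _ _))
  have hερ : ‖(ε : ℂ)‖ ≤ ρ := by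
    rw [Complex.norm_real]
    exact (hε.trans_le (min_le_right _ _)).le
  set μ : ℂ := ε * ψ ε with hμ
  have hμρ : ‖μ‖ ≤ ρ := (h3.trans_le (min_le_right _ _)).le
  have hU := hunit (μ, ε) hμρ hερ
  have hU' := hunit (conj μ, ε) (by rw [RCLike.norm_conj]; exact hμρ) hερ
  have hdet : (secularMatrix B e e' S T (μ, (ε : ℂ))).det = 0 := by
    have h4 : (secularMatrix B e e' S T (μ, (ε : ℂ))).det = (ε : ℂ) ^ 2 * f (ε, ψ ε) := by
      simp only [Matrix.det_fin_two, secularMatrix_apply, f, V, ← hμ]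
      simp only [if_true, zero_ne_one, one_ne_zero, if_false, sub_zero, hμ]
      ring
    rw [h4, h1, mul_zero]
  -- By $J$-symmetry this determinant is the conjugate of the one at `μ`: the two minus signs off
  -- the diagonal cancel in the product.
  have hdet' : (secularMatrix B e e' S T (conj μ, (ε : ℂ))).det = 0 := by
    have hs := hS.secularMatrix_symm J hJ hA hB hJe hU hU'
    have e00 := mul_left_cancel₀ hτ0 (hs 0 0)
    have e11 := mul_left_cancel₀ hτ1 (hs 1 1)
    have e01 := hs 0 1
    have e10 := hs 1 0
    rw [hττ] at e01 e10
    have e01' : secularMatrix B e e' S T (conj μ, (ε : ℂ)) 1 0 =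
        -conj (secularMatrix B e e' S T (μ, (ε : ℂ)) 0 1) := by
      apply mul_left_cancel₀ hτ0
      rw [e01]
      push_cast
      ring
    have e10' : secularMatrix B e e' S T (conj μ, (ε : ℂ)) 0 1 =
        -conj (secularMatrix B e e' S T (μ, (ε : ℂ)) 1 0) := by
      apply mul_left_cancel₀ hτ0
      push_cast at e10
      linear_combination -e10
    have h5 := congrArg conj hdet
    rw [Matrix.det_fin_two, map_sub, map_mul, map_mul, map_zero] at h5
    rw [Matrix.det_fin_two, e00, e11, e01', e10', ← h5]
    ring
  have hex : ∀ ν : ℂ, IsUnit (1 - (ν • S - (ε : ℂ) • T)) →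
      (secularMatrix B e e' S T (ν, (ε : ℂ))).det = 0 →
      ∃ u : D, u ≠ 0 ∧ A u + (ε : ℂ) • B u = ((lam : ℂ) + ν) • (u : H) := by
    intro ν hν hdν
    obtain ⟨v, hv0, hv⟩ := Matrix.exists_vecMul_eq_zero_iff.2 hdν
    obtain ⟨u, hu, hud⟩ := hS.exists_eigenvector (p := (ν, (ε : ℂ))) hν hv
    refine ⟨u, ?_, hu⟩
    rintro rfl
    exact hv0 (funext fun k => by rw [← hud k]; simp)
  refine ⟨μ, ?_, h3.trans_le (min_le_left _ _), hex μ hU hdet, hex _ hU' hdet'⟩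
  rw [hμ, Complex.im_ofReal_mul]
  exact mul_ne_zero (abs_pos.1 hε0) h2.ne'

end IsReducedResolvent

/-! ### Translating the hypotheses on $J$, the bases and the adjoints into inner product identities.
-/

/-- Polarization: the coordinates $(1,1)$ and $(1,i)$ isolate the off-diagonal entries. -/
theorem IsCanonicalBasis.inner_eq {J : H ≃ₗᵢ[ℂ] H} {E : Submodule ℂ H} {e : Fin 2 → H}
    {τ : Fin 2 → ℝ} (he : IsCanonicalBasis J E e τ) (j k : Fin 2) :
    ⟪e j, J (e k)⟫_ℂ = if j = k then (τ j : ℂ) else 0 := by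
  have h00 := he.form_eq ![1, 0]
  have h11 := he.form_eq ![0, 1]
  have hr := he.form_eq ![1, 1]
  have hi := he.form_eq ![1, Complex.I]
  simp [Fin.sum_univ_two, inner_add_left, inner_add_right, inner_smul_left, inner_smul_right]
    at h00 h11 hr hi
  rw [h00, h11] at hr hi
  have h01 : ⟪e 0, J (e 1)⟫_ℂ = 0 := by
    linear_combination (hr - Complex.I * hi) / 2 +
      (⟪e 0, J (e 1)⟫_ℂ - ⟪e 1, J (e 0)⟫_ℂ) / 2 * Complex.I_sq -
      τ 1 * Complex.I / 2 * Complex.I_sq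
  have h10 : ⟪e 1, J (e 0)⟫_ℂ = 0 := by
    rw [h01] at hr
    linear_combination hr
  fin_cases j <;> fin_cases k <;> simp [h00, h11, h01, h10]

/-- Expanding $e_k^*\in JE$ in the vectors $Je_j$, duality fixes the coefficients because
$\tau_j^2=1$. -/
theorem IsDualBasis.eq_smul {J : H ≃ₗᵢ[ℂ] H} (hJ : ∀ u, J (J u) = u) {E : Submodule ℂ H}
    {e e' : Fin 2 → H} {τ : Fin 2 → ℝ} (he : IsCanonicalBasis J E e τ)
    (he' : IsDualBasis J E e e') (k : Fin 2) : e' k = (τ k : ℂ) • J (e k) := by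
  obtain ⟨u, hu, huk⟩ := he'.1 k
  rw [← he.span_eq, Submodule.mem_span_range_iff_exists_fun] at hu
  obtain ⟨c, rfl⟩ := hu
  have hsq : ∀ j, (τ j : ℂ) * τ j = 1 := by
    intro j
    rcases he.sign j with h | h <;> simp [h]
  have hc : ∀ j, conj (c j) * τ j = if k = j then 1 else 0 := by
    intro j
    have h1 := he'.2 k j
    rw [huk, map_sum, sum_inner] at h1
    rw [← h1, Finset.sum_eq_single j]
    · rw [map_smul, inner_smul_left, ← J.inner_map_map, hJ, he.inner_eq, if_pos rfl]
    · intro i _ hij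
      rw [map_smul, inner_smul_left, ← J.inner_map_map, hJ, he.inner_eq, if_neg hij, mul_zero]
    · simp
  have hcτ : ∀ j, c j = if k = j then (τ j : ℂ) else 0 := by
    intro j
    have h1 : conj (c j) = if k = j then (τ j : ℂ) else 0 := by
      calc conj (c j) = conj (c j) * τ j * τ j := by rw [mul_assoc, hsq, mul_one]
        _ = _ := by rw [hc]; split_ifs <;> simp
    rw [← Complex.conj_conj (c j), h1]
    split_ifs <;> simp
  rw [huk, map_sum, Finset.sum_eq_single k]
  · rw [map_smul, hcτ, if_pos rfl]
  · intro i _ hik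
    rw [hcτ, if_neg (Ne.symm hik), zero_smul, map_zero]
  · simp

theorem Intertwines.inner_eq [CompleteSpace H] {J : H ≃ₗᵢ[ℂ] H} {A : H →ₗ.[ℂ] H}
    (hA : Dense (A.domain : Set H)) (h : Intertwines J A) (u x : A.domain) :
    ⟪J (A u), (x : H)⟫_ℂ = ⟪J u, A x⟫_ℂ := by
  have hu := (h.1 u).1 u.2
  rw [← h.2 u hu]
  exact LinearPMap.adjoint_isFormalAdjoint hA ⟨J u, hu⟩ x

theorem IntertwinesOn.inner_eq [CompleteSpace H] {J : H ≃ₗᵢ[ℂ] H} {A : H →ₗ.[ℂ] H}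
    {D : Submodule ℂ H} (hA : Dense (A.domain : Set H)) (h : IntertwinesOn J A D) (u x : A.domain)
    (huD : (u : H) ∈ D) : ⟪J (A u), (x : H)⟫_ℂ = ⟪J u, A x⟫_ℂ := by
  obtain ⟨hu, hu'⟩ := h u huD
  rw [← hu']
  exact LinearPMap.adjoint_isFormalAdjoint hA ⟨J u, hu⟩ x

theorem isEigenvector_add_smul {H₀ H₁ : H →ₗ.[ℂ] H} (hdom : H₀.domain ≤ H₁.domain) {ε z : ℂ}
    {u : H₀.domain} (hu0 : u ≠ 0)
    (hu : H₀ u + ε • H₁ (Submodule.inclusion hdom u) = z • (u : H)) :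
    IsEigenvector (H₀ + ε • H₁) z u := by
  refine ⟨fun h => hu0 (Subtype.ext h), ⟨u.2, hdom u.2⟩, ?_⟩
  rw [← hu, LinearPMap.add_apply]
  rfl

end Eigenvalues

end PTPerturb

/-! ### Assembly of the theorem. -/

theorem theorem1p1 {H : Type*} [NormedAddCommGroup H] [InnerProductSpace ℂ H] [CompleteSpace H]
    (H₀ H₁ : H →ₗ.[ℂ] H)
    (hclosed : H₀.IsClosed) (hdense : Dense (H₀.domain : Set H))
    (hdom : H₀.domain ≤ H₁.domain)
    (J : H ≃ₗᵢ[ℂ] H) (hJ : ∀ u, J (J u) = u) (hJdom : ∀ u ∈ H₀.domain, J u ∈ H₀.domain)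
    (hJ₀ : PTPerturb.Intertwines J H₀) (hJ₁ : PTPerturb.IntertwinesOn J H₁ H₀.domain)
    (lam : ℝ) (hlam : PTPerturb.IsIsolatedSemisimpleEigenvalue H₀ (lam : ℂ) 2)
    (e e' : Fin 2 → H) (τ : Fin 2 → ℝ)
    (he : PTPerturb.IsCanonicalBasis J (PTPerturb.eigenspace H₀ (lam : ℂ)) e τ)
    (he' : PTPerturb.IsDualBasis J (PTPerturb.eigenspace H₀ (lam : ℂ)) e e')
    (hmem : ∀ j, e j ∈ H₁.domain)
    (h : Fin 2 → Fin 2 → ℂ) (hh : ∀ j k, h j k = inner ℂ (e' k) (H₁ ⟨e j, hmem j⟩)) :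
    (h 0 0).im = 0 ∧ (h 1 1).im = 0 ∧
    ∀ δ : ℝ, 0 < δ → ∃ εs : ℝ, 0 < εs ∧
      (τ 0 * τ 1 = -1 → ((h 0 0).re - (h 1 1).re) ^ 2 < 4 * ‖h 0 1‖ ^ 2 →
        ∀ ε : ℝ, 0 < |ε| → |ε| < εs →
          ∃ z : ℂ, z.im ≠ 0 ∧ ‖z - (lam : ℂ)‖ < δ ∧
            PTPerturb.IsEigenvalue (H₀ + (ε : ℂ) • H₁) z ∧
            PTPerturb.IsEigenvalue (H₀ + (ε : ℂ) • H₁) ((starRingEnd ℂ) z)) ∧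
      (τ 0 * τ 1 = 1 →
        ∀ ε : ℝ, |ε| < εs →
          ∃ (μ : Fin 2 → ℝ) (u : Fin 2 → H), LinearIndependent ℂ u ∧
            ∀ j, |μ j - lam| < δ ∧
              PTPerturb.IsEigenvector (H₀ + (ε : ℂ) • H₁) (μ j : ℂ) (u j)) := by
  open PTPerturb in
  have heig : ∀ j, ∃ hj : e j ∈ H₀.domain, H₀ ⟨e j, hj⟩ = (lam : ℂ) • e j := fun j =>
    mem_eigenspace.1 (he.span_eq ▸ Submodule.subset_span ⟨j, rfl⟩)
  choose hD hAe using heig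
  let B : H₀.domain →ₗ[ℂ] H := H₁.toFun ∘ₗ Submodule.inclusion hdom
  let w : Fin 2 → H₀.domain := fun j => ⟨e j, hD j⟩
  have hdense₁ : Dense (H₁.domain : Set H) := hdense.mono hdom
  have hA := hJ₀.inner_eq hdense
  have hB : ∀ u x : H₀.domain, inner ℂ (J (B u)) (x : H) = inner ℂ (J u) (B x) := fun u x =>
    hJ₁.inner_eq hdense₁ (Submodule.inclusion hdom u) (Submodule.inclusion hdom x) u.2
  have he'τ := fun k => he'.eq_smul hJ he k
  have hsq : ∀ j, (τ j : ℂ) * τ j = 1 := by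
    intro j
    rcases he.sign j with h | h <;> simp [h]
  have hJe : ∀ k, J (w k) = (τ k : ℂ) • e' k := fun k => by
    rw [he'τ, smul_smul, hsq, one_smul]
  obtain ⟨S₀, hS₀⟩ := hlam.exists_right_inverse_mod two_pos
  obtain ⟨S, T, hS⟩ := exists_isReducedResolvent (A := H₀.toFun) (B := B) (e := w) (e' := e')
    J hJ hdense hJdom hA hB hAe he'.2 he'τ
    (by rw [← he.span_eq] at hS₀; exact hS₀)
  have hhB : ∀ j k, h j k = inner ℂ (e' k) (B (w j)) := hh
  have hreal : ∀ j, (h j j).im = 0 := by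
    intro j
    have h1 := inner_dual_perturbation_symm J hJ hB hJe j j
    have hτ : (τ j : ℂ) ≠ 0 := left_ne_zero_of_mul_eq_one (hsq j)
    rw [hhB]
    exact Complex.conj_eq_iff_im.1 (mul_left_cancel₀ hτ h1).symm
  refine ⟨hreal 0, hreal 1, fun δ hδ => ?_⟩
  have hpm : τ 0 * τ 1 = -1 → τ 1 = -τ 0 := by
    rcases he.sign 0 with h0 | h0 <;> rcases he.sign 1 with h1 | h1 <;> rw [h0, h1] <;> norm_num
  have hpp : τ 0 * τ 1 = 1 → τ 0 = τ 1 := by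
    rcases he.sign 0 with h0 | h0 <;> rcases he.sign 1 with h1 | h1 <;> rw [h0, h1] <;> norm_num
  have hnonreal : ∃ εs : ℝ, 0 < εs ∧
      (τ 0 * τ 1 = -1 → ((h 0 0).re - (h 1 1).re) ^ 2 < 4 * ‖h 0 1‖ ^ 2 →
        ∀ ε : ℝ, 0 < |ε| → |ε| < εs →
          ∃ z : ℂ, z.im ≠ 0 ∧ ‖z - (lam : ℂ)‖ < δ ∧
            IsEigenvalue (H₀ + (ε : ℂ) • H₁) z ∧
            IsEigenvalue (H₀ + (ε : ℂ) • H₁) ((starRingEnd ℂ) z)) := by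
    -- The case conditions do not involve `ε`, so a threshold can be chosen after deciding them; any
    -- positive value serves when they fail.
    by_cases hc : τ 0 * τ 1 = -1 ∧ ((h 0 0).re - (h 1 1).re) ^ 2 < 4 * ‖h 0 1‖ ^ 2
    · obtain ⟨hτ, hlt⟩ := hc
      simp only [hhB] at hlt
      obtain ⟨εs, hεs, hex⟩ :=
        hS.exists_nonreal_eigenvalues J hJ hA hB hJe hτ (hpm hτ) hlt hδ
      refine ⟨εs, hεs, fun _ _ ε hε0 hε => ?_⟩
      obtain ⟨μ, him, hμ, ⟨u, hu0, hu⟩, ⟨v, hv0, hv⟩⟩ := hex ε hε0 hε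
      refine ⟨lam + μ, by simpa using him, by simpa using hμ, ⟨u, isEigenvector_add_smul hdom hu0 hu⟩,
        ⟨v, isEigenvector_add_smul hdom hv0 ?_⟩⟩
      rw [map_add, Complex.conj_ofReal]
      exact hv
    · exact ⟨1, one_pos, fun h1 h2 => absurd ⟨h1, h2⟩ hc⟩
  have hdef : ∃ εs : ℝ, 0 < εs ∧
      (τ 0 * τ 1 = 1 →
        ∀ ε : ℝ, |ε| < εs →
          ∃ (μ : Fin 2 → ℝ) (u : Fin 2 → H), LinearIndependent ℂ u ∧
            ∀ j, |μ j - lam| < δ ∧ IsEigenvector (H₀ + (ε : ℂ) • H₁) (μ j : ℂ) (u j)) := by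
    by_cases hτ : τ 0 * τ 1 = 1
    · obtain ⟨εs, hεs, hex⟩ :=
        hS.exists_real_eigenvalues J hJ hA hB hJe hτ (hpp hτ) hδ
      refine ⟨εs, hεs, fun _ ε hε => ?_⟩
      obtain ⟨μ, u, hli, hu⟩ := hex ε hε
      refine ⟨fun j => lam + μ j, fun j => u j, hli, fun j => ⟨by simpa using (hu j).1, ?_⟩⟩
      refine isEigenvector_add_smul hdom (fun h0 => hli.ne_zero j ?_) ?_
      · simp [h0]
      · push_cast
        exact (hu j).2
    · exact ⟨1, one_pos, fun h1 => absurd h1 hτ⟩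
  obtain ⟨ε₁, hε₁, h₁⟩ := hnonreal
  obtain ⟨ε₂, hε₂, h₂⟩ := hdef
  exact ⟨min ε₁ ε₂, lt_min hε₁ hε₂,
    fun ha hb ε h0 hε => h₁ ha hb ε h0 (hε.trans_le (min_le_left _ _)),
    fun ha ε hε => h₂ ha ε (hε.trans_le (min_le_right _ _))⟩
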